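/- A \emph{pseudocomplemented distributive lattice} is an algebra $\langle A;\wedge,\vee,\neg,0,1\rangle$ such that $\langle A;\wedge,\vee,0,1\rangle$ is a bounded distributive lattice and $a\le\neg b\iff a\wedge b=0$ for all $a,b\in A$; homomorphisms, embeddings, isomorphisms and subalgebras refer to all of $\wedge,\vee,\neg,0,1$. Let $\mathsf{PDL}$ be the variety of these algebras and $\boldsymbol F_{\mathsf{PDL}}(\aleph_0)$ its free algebra with $\aleph_0$ free generators, that is, the algebra of terms in countably many variables modulo the equations valid in $\mathsf{PDL}$. For $A\in\mathsf{PDL}$ let $A_*$ be the poset of prime filters of $A$ ordered by inclusion (the underlying poset of the Priestley dual of $A$). For a subset $Y$ of a poset $X$ let $\max Y$ be the set of maximal elements of $Y$, and for $x\in X$ let ${\uparrow}x=\{z\in X: x\le z\}$. A poset $X$ with minimum $\bot$ \emph{has a free skeleton} when one can choose an element $s_{x,Y}\in X$ for all $x\in X$ and nonempty $Y\subseteq\max{\uparrow}x$ in such a way that (i) $s_{x,Y}\in{\uparrow}x$ and $Y=\max{\uparrow}s_{x,Y}$ for all $x\in X$ and nonempty $Y\subseteq\max{\uparrow}x$; (ii)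 $Y\subseteq Z$ implies $s_{x,Z}\le s_{x,Y}$ for all $x\in X$ and nonempty $Y,Z\subseteq\max{\uparrow}x$; (iii) $\max{\uparrow}x\subseteq Y$ implies $s_{\bot,Y}\le x$ for all $x\in X$ and nonempty $Y\subseteq\max X$. (In particular, a poset with a free skeleton has a minimum, hence is nonempty.) An algebra $A\in\mathsf{PDL}$ is \emph{exact} in $\mathsf{PDL}$ if it is isomorphic to a finitely generated subalgebra of $\boldsymbol F_{\mathsf{PDL}}(\aleph_0)$. \textbf{Proposition.} Let $A\in\mathsf{PDL}$. (1) If $A$ is finite, then $A$ embeds into $\boldsymbol F_{\mathsf{PDL}}(\aleph_0)$ if and only if the poset $A_*$ has a free skeleton. (2) $A$ is exact in $\mathsf{PDL}$ if and only if $A$ is finite and the poset $A_*$ has a free skeleton. -/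

import Mathlib

/-- A pseudocomplemented distributive lattice: a bounded distributive lattice together with a unary
operation `ᶜ` such that `a ≤ bᶜ ↔ a ⊓ b = ⊥`. -/
class PDLattice (A : Type*) extends DistribLattice A, BoundedOrder A, Compl A where
  le_compl_iff : ∀ a b : A, a ≤ bᶜ ↔ a ⊓ b = ⊥

/-- Homomorphisms of pseudocomplemented distributive lattices. -/
structure PDLHom (A B : Type*) [PDLattice A] [PDLattice B] extends BoundedLatticeHom A B where
  map_compl' : ∀ a : A, toFun aᶜ = (toFun a)ᶜ

/-- `A` embeds into `B`: there is an injective homomorphism from `A` to `B`. -/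
def PDLEmbeds (A B : Type*) [PDLattice A] [PDLattice B] : Prop :=
  ∃ f : PDLHom A B, Function.Injective f.toFun

/-- `A` and `B` are isomorphic: there is a bijective homomorphism from `A` to `B`. -/
def PDLIsomorphic (A B : Type*) [PDLattice A] [PDLattice B] : Prop :=
  ∃ f : PDLHom A B, Function.Bijective f.toFun

/-! ### Subalgebras -/

/-- Subuniverses of a pseudocomplemented distributive lattice: subsets closed under all the basic
operations `⊓, ⊔, ᶜ, ⊥, ⊤`. -/
structure PDLSubalgebra (A : Type*) [PDLattice A] where
  carrier : Set A
  inf_mem : ∀ {a b : A}, a ∈ carrier → b ∈ carrier → a ⊓ b ∈ carrier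
  sup_mem : ∀ {a b : A}, a ∈ carrier → b ∈ carrier → a ⊔ b ∈ carrier
  compl_mem : ∀ {a : A}, a ∈ carrier → aᶜ ∈ carrier
  bot_mem : ⊥ ∈ carrier
  top_mem : ⊤ ∈ carrier

namespace PDLSubalgebra

/-- The subalgebra with the restricted operations. -/
instance instPDLattice {A : Type*} [PDLattice A] (S : PDLSubalgebra A) : PDLattice S.carrier where
  toDistribLattice :=
    { (inferInstance : PartialOrder S.carrier) with
      sup := fun a b => ⟨a.1 ⊔ b.1, S.sup_mem a.2 b.2⟩
      inf := fun a b => ⟨a.1 ⊓ b.1, S.inf_mem a.2 b.2⟩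
      le_sup_left := fun a b => (le_sup_left : a.1 ≤ a.1 ⊔ b.1)
      le_sup_right := fun a b => (le_sup_right : b.1 ≤ a.1 ⊔ b.1)
      sup_le := fun a b c (h : a.1 ≤ c.1) (h' : b.1 ≤ c.1) => (sup_le h h' : a.1 ⊔ b.1 ≤ c.1)
      inf_le_left := fun a b => (inf_le_left : a.1 ⊓ b.1 ≤ a.1)
      inf_le_right := fun a b => (inf_le_right : a.1 ⊓ b.1 ≤ b.1)
      le_inf := fun a b c (h : a.1 ≤ b.1) (h' : a.1 ≤ c.1) => (le_inf h h' : a.1 ≤ b.1 ⊓ c.1)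
      le_sup_inf := fun a b c =>
        (le_sup_inf : (a.1 ⊔ b.1) ⊓ (a.1 ⊔ c.1) ≤ a.1 ⊔ b.1 ⊓ c.1) }
  top := ⟨⊤, S.top_mem⟩
  le_top a := (le_top : a.1 ≤ ⊤)
  bot := ⟨⊥, S.bot_mem⟩
  bot_le a := (bot_le : ⊥ ≤ a.1)
  compl a := ⟨a.1ᶜ, S.compl_mem a.2⟩
  le_compl_iff a b := (PDLattice.le_compl_iff a.1 b.1).trans
    ⟨fun h => Subtype.ext h, fun h => congrArg Subtype.val h⟩

/-- The subalgebra generated by a set `X`: the intersection of all subalgebras containing `X`. -/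
def closure {A : Type*} [PDLattice A] (X : Set A) : PDLSubalgebra A where
  carrier := {a | ∀ S : PDLSubalgebra A, X ⊆ S.carrier → a ∈ S.carrier}
  inf_mem ha hb := fun S h => S.inf_mem (ha S h) (hb S h)
  sup_mem ha hb := fun S h => S.sup_mem (ha S h) (hb S h)
  compl_mem ha := fun S h => S.compl_mem (ha S h)
  bot_mem := fun S _ => S.bot_mem
  top_mem := fun S _ => S.top_mem

/-- A subalgebra is finitely generated when it is generated by a finite set. -/
def IsFinitelyGenerated {A : Type*} [PDLattice A] (S : PDLSubalgebra A) : Prop :=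
  ∃ X : Set A, X.Finite ∧ S = closure X

end PDLSubalgebra

/-! ### Free algebras -/

/-- Terms with variables in `X` in the language of pseudocomplemented distributive lattices. -/
inductive PDLTerm (X : Type*) where
  | var (x : X) : PDLTerm X
  | bot : PDLTerm X
  | top : PDLTerm X
  | compl (t : PDLTerm X) : PDLTerm X
  | inf (t s : PDLTerm X) : PDLTerm X
  | sup (t s : PDLTerm X) : PDLTerm X

namespace PDLTerm

/-- Evaluation of a term in an algebra under an assignment of the variables. -/
def eval {X A : Type*} [PDLattice A] (v : X → A) : PDLTerm X → A
  | var x => v x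
  | bot => ⊥
  | top => ⊤
  | compl t => (eval v t)ᶜ
  | inf t s => eval v t ⊓ eval v s
  | sup t s => eval v t ⊔ eval v s

universe u in
/-- The equation `t ≈ s` is valid in all pseudocomplemented distributive lattices. These range over
the universe of `X`; by `PDLFree.eval_eq_of_valid` below the equation is then valid in
pseudocomplemented distributive lattices of every universe. -/
def Valid {X : Type u} (t s : PDLTerm X) : Prop :=
  ∀ (A : Type u) [PDLattice A] (v : X → A), t.eval v = s.eval v

/-- The congruence of valid equations on the term algebra. -/
def validSetoid (X : Type*) : Setoid (PDLTerm X) where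
  r := Valid
  iseqv :=
    ⟨fun _ _ _ _ => rfl, fun h A _ v => (h A v).symm, fun h h' A _ v => (h A v).trans (h' A v)⟩

end PDLTerm

/-- The free pseudocomplemented distributive lattice with set of free generators `X`: the quotient
of the term algebra by the congruence of valid equations. The free algebra with `ℵ₀` free generators
is `PDLFree ℕ`. -/
def PDLFree (X : Type*) : Type _ := Quotient (PDLTerm.validSetoid X)

namespace PDLFree

/-- The class of a term. -/
def mk {X : Type*} (t : PDLTerm X) : PDLFree X := Quotient.mk (PDLTerm.validSetoid X) t

theorem mk_eq_mk {X : Type*} {t s : PDLTerm X} : mk t = mk s ↔ t.Valid s :=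
  ⟨fun h => Quotient.exact h, fun h => Quotient.sound (s := PDLTerm.validSetoid X) h⟩

instance instLattice (X : Type*) : Lattice (PDLFree X) :=
  letI : Max (PDLFree X) := ⟨Quotient.map₂ PDLTerm.sup fun _ _ h _ _ h' A _ v =>
    congrArg₂ (· ⊔ ·) (h A v) (h' A v)⟩
  letI : Min (PDLFree X) := ⟨Quotient.map₂ PDLTerm.inf fun _ _ h _ _ h' A _ v =>
    congrArg₂ (· ⊓ ·) (h A v) (h' A v)⟩
  Lattice.mk'
    (by rintro ⟨a⟩ ⟨b⟩; exact mk_eq_mk.2 fun A _ v => sup_comm _ _)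
    (by rintro ⟨a⟩ ⟨b⟩ ⟨c⟩; exact mk_eq_mk.2 fun A _ v => sup_assoc _ _ _)
    (by rintro ⟨a⟩ ⟨b⟩; exact mk_eq_mk.2 fun A _ v => inf_comm _ _)
    (by rintro ⟨a⟩ ⟨b⟩ ⟨c⟩; exact mk_eq_mk.2 fun A _ v => inf_assoc _ _ _)
    (by rintro ⟨a⟩ ⟨b⟩; exact mk_eq_mk.2 fun A _ v => sup_inf_self)
    (by rintro ⟨a⟩ ⟨b⟩; exact mk_eq_mk.2 fun A _ v => inf_sup_self)

theorem mk_le_mk {X : Type*} {t s : PDLTerm X} : mk t ≤ mk s ↔ (PDLTerm.inf t s).Valid t :=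
  inf_eq_left.symm.trans mk_eq_mk

/-- The operations on `PDLFree X` are induced by those of the term algebra. -/
instance instPDLattice (X : Type*) : PDLattice (PDLFree X) where
  toDistribLattice :=
    { instLattice X with
      le_sup_inf := by
        rintro ⟨a⟩ ⟨b⟩ ⟨c⟩
        exact mk_le_mk.2 fun A _ v => inf_eq_left.2 le_sup_inf }
  top := mk .top
  le_top := by rintro ⟨a⟩; exact mk_le_mk.2 fun A _ v => inf_top_eq _
  bot := mk .bot
  bot_le := by rintro ⟨a⟩; exact mk_le_mk.2 fun A _ v => bot_inf_eq _
  compl := Quotient.map PDLTerm.compl fun _ _ h A _ v => congrArg (·ᶜ) (h A v)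
  le_compl_iff := by
    rintro ⟨a⟩ ⟨b⟩
    refine Iff.trans (mk_le_mk (t := a) (s := b.compl)) (Iff.trans ?_
      (mk_eq_mk (t := a.inf b) (s := .bot)).symm)
    exact forall_congr' fun A => forall_congr' fun _ => forall_congr' fun v =>
      inf_eq_left.trans (PDLattice.le_compl_iff (a.eval v) (b.eval v))

/-- Valid equations hold in pseudocomplemented distributive lattices of every universe. -/
theorem eval_eq_of_valid {X A : Type*} [PDLattice A] {t s : PDLTerm X} (h : t.Valid s)
    (v : X → A) : t.eval v = s.eval v := by
  let Q := Quotient (Setoid.ker (PDLTerm.eval v))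
  let q : PDLTerm X → Q := Quotient.mk _
  let j : Q → A := Quotient.lift (PDLTerm.eval v) fun _ _ h => h
  have hj : Function.Injective j := by
    rintro ⟨a⟩ ⟨b⟩ hab
    exact Quotient.sound (s := Setoid.ker (PDLTerm.eval v)) hab
  let inst : PDLattice Q :=
    { PartialOrder.lift j hj with
      sup := Quotient.map₂ PDLTerm.sup fun _ _ h _ _ h' => congrArg₂ (· ⊔ ·) h h'
      inf := Quotient.map₂ PDLTerm.inf fun _ _ h _ _ h' => congrArg₂ (· ⊓ ·) h h'
      le_sup_left := by
        rintro ⟨a⟩ ⟨b⟩; exact (le_sup_left : a.eval v ≤ a.eval v ⊔ b.eval v)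
      le_sup_right := by
        rintro ⟨a⟩ ⟨b⟩; exact (le_sup_right : b.eval v ≤ a.eval v ⊔ b.eval v)
      sup_le := by
        rintro ⟨a⟩ ⟨b⟩ ⟨c⟩ h h'
        exact (sup_le h h' : a.eval v ⊔ b.eval v ≤ c.eval v)
      inf_le_left := by
        rintro ⟨a⟩ ⟨b⟩; exact (inf_le_left : a.eval v ⊓ b.eval v ≤ a.eval v)
      inf_le_right := by
        rintro ⟨a⟩ ⟨b⟩; exact (inf_le_right : a.eval v ⊓ b.eval v ≤ b.eval v)
      le_inf := by
        rintro ⟨a⟩ ⟨b⟩ ⟨c⟩ h h'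
        exact (le_inf h h' : a.eval v ≤ b.eval v ⊓ c.eval v)
      le_sup_inf := by
        rintro ⟨a⟩ ⟨b⟩ ⟨c⟩
        exact (le_sup_inf : (a.eval v ⊔ b.eval v) ⊓ (a.eval v ⊔ c.eval v) ≤
          a.eval v ⊔ b.eval v ⊓ c.eval v)
      top := q .top
      le_top := by rintro ⟨a⟩; exact (le_top : a.eval v ≤ ⊤)
      bot := q .bot
      bot_le := by rintro ⟨a⟩; exact (bot_le : ⊥ ≤ a.eval v)
      compl := Quotient.map PDLTerm.compl fun _ _ h => congrArg (·ᶜ) h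
      le_compl_iff := by
        rintro ⟨a⟩ ⟨b⟩
        exact (PDLattice.le_compl_iff (a.eval v) (b.eval v)).trans
          ⟨fun h => hj h, fun h => congrArg j h⟩ }
  have key : ∀ t : PDLTerm X, t.eval (fun x => q (.var x)) = q t := by
    intro t
    induction t with
    | var x => rfl
    | bot => rfl
    | top => rfl
    | compl t ih => exact congrArg (·ᶜ) ih
    | inf t s iht ihs => exact congrArg₂ (· ⊓ ·) iht ihs
    | sup t s iht ihs => exact congrArg₂ (· ⊔ ·) iht ihs
  have h' := h Q fun x => q (.var x)
  rw [key, key] at h'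
  exact congrArg j h'

/-- The universal property: every map from `X` to a pseudocomplemented distributive lattice, in any
universe, extends uniquely to a homomorphism on `PDLFree X`. -/
theorem existsUnique_lift {X A : Type*} [PDLattice A] (v : X → A) :
    ∃! f : PDLHom (PDLFree X) A, ∀ x, f.toFun (mk (.var x)) = v x := by
  refine ⟨{ toFun := Quotient.lift (PDLTerm.eval v) fun _ _ h => eval_eq_of_valid h v
            map_sup' := by rintro ⟨a⟩ ⟨b⟩; rfl
            map_inf' := by rintro ⟨a⟩ ⟨b⟩; rfl
            map_top' := rfl
            map_bot' := rfl
            map_compl' := by rintro ⟨a⟩; rfl }, fun _ => rfl, ?_⟩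
  rintro ⟨g, hg⟩ hv
  have key : ∀ t : PDLTerm X, g (mk t) = t.eval v := by
    intro t
    induction t with
    | var x => exact hv x
    | bot => exact g.map_bot'
    | top => exact g.map_top'
    | compl t ih => exact (hg (mk t)).trans (congrArg (·ᶜ) ih)
    | inf t s iht ihs => exact (g.map_inf' (mk t) (mk s)).trans (congrArg₂ (· ⊓ ·) iht ihs)
    | sup t s iht ihs => exact (g.map_sup' (mk t) (mk s)).trans (congrArg₂ (· ⊔ ·) iht ihs)
  congr 1
  ext ⟨t⟩
  exact key t

end PDLFree

/-! ### Duals and free skeletons -/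

/-- The poset of prime filters of `A` ordered by inclusion, which is the poset underlying the
Priestley dual of `A`. -/
abbrev PDLDual (A : Type*) [PDLattice A] : Type _ :=
  {F : Order.PFilter A // F.IsPrime}

/-- The set of maximal elements of a subset `Y` of a poset. -/
def maxElems {P : Type*} [PartialOrder P] (Y : Set P) : Set P := {y | Maximal (· ∈ Y) y}

/-- A poset with minimum `m` has a free skeleton, witnessed by the elements `s x Y`. The values of
`s x Y` are only relevant when `Y` is a nonempty subset of `maxElems (Set.Ici x)`. -/
def HasFreeSkeleton (P : Type*) [PartialOrder P] : Prop :=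
  ∃ m : P, IsLeast Set.univ m ∧ ∃ s : P → Set P → P,
    (∀ (x : P) (Y : Set P), Y.Nonempty → Y ⊆ maxElems (Set.Ici x) →
      s x Y ∈ Set.Ici x ∧ Y = maxElems (Set.Ici (s x Y))) ∧
    (∀ (x : P) (Y Z : Set P), Y.Nonempty → Z.Nonempty →
      Y ⊆ maxElems (Set.Ici x) → Z ⊆ maxElems (Set.Ici x) → Y ⊆ Z → s x Z ≤ s x Y) ∧
    (∀ (x : P) (Y : Set P), Y.Nonempty → Y ⊆ maxElems (Set.univ : Set P) →
      maxElems (Set.Ici x) ⊆ Y → s m Y ≤ x)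

/-- `A` is exact: it is isomorphic to a finitely generated subalgebra of the free
pseudocomplemented distributive lattice with `ℵ₀` free generators. -/
def IsExactPDL (A : Type*) [PDLattice A] : Prop :=
  ∃ S : PDLSubalgebra (PDLFree ℕ), S.IsFinitelyGenerated ∧ PDLIsomorphic A S.carrier

/-! ### Prime filters -/

section PrimeFilters

variable {A : Type*} [PDLattice A]

/-! The proof is a concrete duality. Whether aᶜ lies in a prime filter x depends only on the maximal
filters above x (`PDLDual.compl_mem_iff`). So x influences the value of a term only through the
variables it contains and the family of variable sets of the maximal filters above it, that is,
through a `FreePoint`. Hence `PDLFree X` embeds into `Upsets (FreePoint X)`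
(`PDLFree.lift_gen_injective`), and for finite X the embedding is onto
(`PDLFree.lift_gen_surjective`).

For finite A, embeddings into free algebras thus become monotone surjections f from points onto the
dual of A that carry the maximal points above p onto the maximal elements above f p. Given such an
f, take a preimage (v, S) of x and keep in S only the sets w with f (pure w) ∈ Y: the image of this
point is s_{x,Y}. Using (∅, all sets) as preimage of the minimum yields condition (iii)
(`hasFreeSkeleton_of_embeds`).

Conversely, a skeleton says where to send points (`HasFreeSkeleton.exists_surjective`). Some
variables serve as labels x, and the family of a point determines a set Y of maximal elements. A
point with a usable label x goes to s_{x,Y}, one without to s_{⊥,Y}; conditions (ii) and (iii) make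
this monotone. The statement on exactness follows by local finiteness. -/

theorem PDLattice.inf_compl_eq_bot (a : A) : a ⊓ aᶜ = ⊥ := by
  rw [inf_comm]; exact (PDLattice.le_compl_iff _ _).1 le_rfl

theorem PDLattice.compl_anti {a b : A} (h : a ≤ b) : bᶜ ≤ aᶜ :=
  (PDLattice.le_compl_iff _ _).2 (le_bot_iff.1 ((inf_le_inf_left _ h).trans
    (by rw [inf_comm, PDLattice.inf_compl_eq_bot])))

/-- The element `a ⊔ aᶜ` is dense. -/
theorem PDLattice.compl_sup_compl_self (a : A) : (a ⊔ aᶜ)ᶜ = ⊥ := by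
  have h1 : (a ⊔ aᶜ)ᶜ ≤ aᶜ := PDLattice.compl_anti le_sup_left
  have h2 : (a ⊔ aᶜ)ᶜ ≤ (a ⊔ aᶜ) := h1.trans le_sup_right
  have h3 := PDLattice.inf_compl_eq_bot (a ⊔ aᶜ)
  rwa [inf_eq_right.2 h2] at h3

namespace PDLDual

theorem bot_notMem (x : PDLDual A) : (⊥ : A) ∉ x.1 := fun h =>
  x.2.compl_ideal.Nonempty.elim fun _ ha => ha (Order.PFilter.mem_of_le bot_le h)

theorem inf_mem_iff (x : PDLDual A) {a b : A} : a ⊓ b ∈ x.1 ↔ a ∈ x.1 ∧ b ∈ x.1 :=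
  ⟨fun h => ⟨Order.PFilter.mem_of_le inf_le_left h, Order.PFilter.mem_of_le inf_le_right h⟩,
    fun h => Order.PFilter.inf_mem h.1 h.2⟩

theorem sup_mem_iff (x : PDLDual A) {a b : A} : a ⊔ b ∈ x.1 ↔ a ∈ x.1 ∨ b ∈ x.1 := by
  refine ⟨fun h => ?_, fun h => h.elim (Order.PFilter.mem_of_le le_sup_left)
    (Order.PFilter.mem_of_le le_sup_right)⟩
  by_contra! hn
  obtain ⟨c, hc, hac, hbc⟩ := x.2.compl_ideal.Directed a hn.1 b hn.2
  exact hc (Order.PFilter.mem_of_le (sup_le hac hbc) h)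

theorem compl_notMem (x : PDLDual A) {a : A} (h : a ∈ x.1) : aᶜ ∉ x.1 := fun h' =>
  x.bot_notMem (PDLattice.inf_compl_eq_bot a ▸ x.inf_mem_iff.2 ⟨h, h'⟩)

/-- The prime filter with a given underlying set. -/
def ofSet (F : Set A) (top_mem : ⊤ ∈ F) (bot_notMem : ⊥ ∉ F)
    (inf_mem : ∀ a b, a ⊓ b ∈ F ↔ a ∈ F ∧ b ∈ F) (sup_mem : ∀ a b, a ⊔ b ∈ F ↔ a ∈ F ∨ b ∈ F) :
    PDLDual A :=
  have mono : ∀ {a b : A}, a ≤ b → a ∈ F → b ∈ F := fun {a b} h ha =>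
    ((inf_mem a b).1 (by rwa [inf_eq_left.2 h])).2
  ⟨(Order.IsPFilter.of_def ⟨⊤, top_mem⟩
      (fun a ha b hb => ⟨a ⊓ b, (inf_mem a b).2 ⟨ha, hb⟩, inf_le_left, inf_le_right⟩)
      mono).toPFilter,
    ⟨{ IsLowerSet := fun _ _ h ha hb => ha (mono h hb)
       Nonempty := ⟨⊥, bot_notMem⟩
       Directed := fun a ha b hb => ⟨a ⊔ b, fun h => ((sup_mem a b).1 h).elim ha hb,
         le_sup_left, le_sup_right⟩ }⟩⟩

/-- A filter disjoint from an ideal extends to a prime filter disjoint from this ideal. -/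
theorem exists_of_disjoint {F : Order.PFilter A} {I : Order.Ideal A}
    (h : Disjoint (F : Set A) (I : Set A)) :
    ∃ x : PDLDual A, (∀ a ∈ F, a ∈ x.1) ∧ ∀ a ∈ I, a ∉ x.1 := by
  obtain ⟨J, hJ, hIJ, hFJ⟩ := DistribLattice.prime_ideal_of_disjoint_filter_ideal h
  refine ⟨ofSet (J : Set A)ᶜ hJ.top_notMem (fun h => h J.bot_mem) (fun a b => ?_) (fun a b => ?_),
    fun a ha => Set.disjoint_left.1 hFJ ha, fun a ha h => h (hIJ ha)⟩
  · refine ⟨fun h => ⟨fun ha => h (J.lower inf_le_left ha), fun hb => h (J.lower inf_le_right hb)⟩,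
      fun h hab => (hJ.mem_or_mem hab).elim h.1 h.2⟩
  · have : a ⊔ b ∈ J ↔ a ∈ J ∧ b ∈ J := Order.Ideal.sup_mem_iff
    change ¬ (a ⊔ b ∈ J) ↔ ¬ (a ∈ J) ∨ ¬ (b ∈ J)
    rw [this, not_and_or]

theorem exists_mem_notMem {a b : A} (h : ¬ a ≤ b) : ∃ x : PDLDual A, a ∈ x.1 ∧ b ∉ x.1 := by
  obtain ⟨x, h1, h2⟩ := exists_of_disjoint (F := Order.PFilter.principal a)
    (I := Order.Ideal.principal b)
    (Set.disjoint_left.2 fun c hc hc' => h ((show a ≤ c from hc).trans hc'))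
  exact ⟨x, h1 a le_rfl, h2 b le_rfl⟩

/-- A prime filter deciding all elements. -/
def Decides (x : PDLDual A) : Prop := ∀ a : A, a ∈ x.1 ∨ aᶜ ∈ x.1

/-- The filter generated by x, a and the dense elements (those d with dᶜ = ⊥) is proper since aᶜ ∉
x. Every b ⊔ bᶜ is dense, so a prime extension of this filter decides all elements. -/
theorem exists_decides (x : PDLDual A) {a : A} (ha : aᶜ ∉ x.1) :
    ∃ y : PDLDual A, x ≤ y ∧ y.Decides ∧ a ∈ y.1 := by
  let F : Set A := {b | ∃ c ∈ x.1, ∃ d : A, dᶜ = ⊥ ∧ (c ⊓ a) ⊓ d ≤ b}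
  -- Only ⊥ is disjoint from a dense element.
  have key : ∀ {c d : A}, dᶜ = ⊥ → c ⊓ d = ⊥ → c = ⊥ := fun {c d} hd h =>
    le_bot_iff.1 (hd ▸ (PDLattice.le_compl_iff c d).2 h)
  have top_dense : (⊤ : A)ᶜ = ⊥ := by
    simpa using PDLattice.inf_compl_eq_bot (⊤ : A)
  have hF : Order.IsPFilter F := by
    refine Order.IsPFilter.of_def ⟨⊤, ⊤, Order.PFilter.top_mem, ⊤, top_dense, le_top⟩ ?_ ?_
    · rintro b ⟨c, hc, d, hd, hb⟩ b' ⟨c', hc', d', hd', hb'⟩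
      refine ⟨b ⊓ b', ⟨c ⊓ c', x.inf_mem_iff.2 ⟨hc, hc'⟩, d ⊓ d', ?_, le_inf ?_ ?_⟩,
        inf_le_left, inf_le_right⟩
      · refine key hd (key hd' ?_)
        rw [inf_assoc, inf_comm]
        exact PDLattice.inf_compl_eq_bot _
      · exact le_trans (inf_le_inf (inf_le_inf_right _ inf_le_left) inf_le_left) hb
      · exact le_trans (inf_le_inf (inf_le_inf_right _ inf_le_right) inf_le_right) hb'
    · rintro b b' h ⟨c, hc, d, hd, hb⟩
      exact ⟨c, hc, d, hd, hb.trans h⟩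
  obtain ⟨y, hy, -⟩ := exists_of_disjoint (F := hF.toPFilter) (I := Order.Ideal.principal ⊥) (by
    refine Set.disjoint_left.2 ?_
    rintro b ⟨c, hc, d, hd, hb⟩ hb'
    have h1 := key hd (le_bot_iff.1 (hb.trans hb'))
    exact ha (Order.PFilter.mem_of_le ((PDLattice.le_compl_iff c a).2 h1) hc))
  refine ⟨y, fun c hc => hy c ⟨c, hc, ⊤, top_dense, inf_le_left.trans inf_le_left⟩,
    fun b => ?_, hy a ⟨⊤, Order.PFilter.top_mem, ⊤, top_dense, inf_le_left.trans inf_le_right⟩⟩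
  exact y.sup_mem_iff.1 (hy _ ⟨⊤, Order.PFilter.top_mem, b ⊔ bᶜ,
    PDLattice.compl_sup_compl_self b, inf_le_right⟩)

theorem Decides.mono {x y : PDLDual A} (hx : x.Decides) (h : x ≤ y) : y.Decides :=
  fun a => (hx a).imp (fun ha => h ha) (fun ha => h ha)

theorem Decides.eq_of_le {x y : PDLDual A} (hx : x.Decides) (h : x ≤ y) : x = y :=
  le_antisymm h fun a ha => (hx a).resolve_right fun h' => y.compl_notMem ha (h h')

theorem exists_ge_decides (x : PDLDual A) : ∃ y : PDLDual A, x ≤ y ∧ y.Decides := by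
  have h : (⊤ : A)ᶜ ∉ x.1 := x.compl_notMem Order.PFilter.top_mem
  obtain ⟨y, h1, h2, -⟩ := x.exists_decides h
  exact ⟨y, h1, h2⟩

/-- Every prime filter lies below a deciding one, and a deciding one has no proper prime extension,
as this would contain some a together with aᶜ. -/
theorem mem_maxElems_Ici {x y : PDLDual A} : y ∈ maxElems (Set.Ici x) ↔ x ≤ y ∧ y.Decides := by
  constructor
  · intro h
    refine ⟨h.1, ?_⟩
    obtain ⟨z, hz, hd⟩ := y.exists_ge_decides
    exact hd.mono (h.2 (le_trans h.1 hz) hz)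
  · rintro ⟨h, hd⟩
    exact ⟨h, fun z _ hyz => (hd.eq_of_le hyz).ge⟩

theorem compl_mem_iff (x : PDLDual A) {a : A} :
    aᶜ ∈ x.1 ↔ ∀ y ∈ maxElems (Set.Ici x), a ∉ y.1 := by
  refine ⟨fun h y hy ha => y.compl_notMem ha (hy.1 h), fun h => ?_⟩
  by_contra hn
  obtain ⟨y, h1, h2, h3⟩ := x.exists_decides hn
  exact h y (mem_maxElems_Ici.2 ⟨h1, h2⟩) h3

end PDLDual

end PrimeFilters

/-! ### Homomorphisms -/

section Homomorphisms

variable {A B C : Type*} [PDLattice A] [PDLattice B] [PDLattice C]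

namespace PDLHom

theorem map_compl (f : PDLHom A B) (a : A) : f.toFun aᶜ = (f.toFun a)ᶜ := f.map_compl' a

theorem map_inf (f : PDLHom A B) (a b : A) : f.toFun (a ⊓ b) = f.toFun a ⊓ f.toFun b :=
  f.map_inf' a b

theorem map_sup (f : PDLHom A B) (a b : A) : f.toFun (a ⊔ b) = f.toFun a ⊔ f.toFun b :=
  f.map_sup' a b

theorem map_top (f : PDLHom A B) : f.toFun ⊤ = ⊤ := f.map_top'

theorem map_bot (f : PDLHom A B) : f.toFun ⊥ = ⊥ := f.map_bot'

theorem mono (f : PDLHom A B) {a b : A} (h : a ≤ b) : f.toFun a ≤ f.toFun b := by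
  rw [← inf_eq_left, ← f.map_inf, inf_eq_left.2 h]

theorem le_of_map_le (f : PDLHom A B) (hf : Function.Injective f.toFun) {a b : A}
    (h : f.toFun a ≤ f.toFun b) : a ≤ b := by
  rw [← inf_eq_left] at h ⊢
  exact hf ((f.map_inf a b).trans h)

def comp (g : PDLHom B C) (f : PDLHom A B) : PDLHom A C where
  toFun a := g.toFun (f.toFun a)
  map_sup' a b := by rw [f.map_sup, g.map_sup]
  map_inf' a b := by rw [f.map_inf, g.map_inf]
  map_top' := by rw [f.map_top, g.map_top]
  map_bot' := by rw [f.map_bot, g.map_bot]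
  map_compl' a := by rw [f.map_compl, g.map_compl]

/-- A homomorphism into `C` whose values are taken by an injective homomorphism `e : B → C` factors
through `e`. -/
theorem exists_factor (e : PDLHom B C) (he : Function.Injective e.toFun) (f : PDLHom A C)
    (h : ∀ a, ∃ b, e.toFun b = f.toFun a) :
    ∃ g : PDLHom A B, ∀ a, e.toFun (g.toFun a) = f.toFun a := by
  choose g hg using h
  exact ⟨{
    toFun := g
    map_sup' := fun a b => he (by rw [e.map_sup, hg, hg, hg, f.map_sup])
    map_inf' := fun a b => he (by rw [e.map_inf, hg, hg, hg, f.map_inf])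
    map_top' := he (by rw [hg, e.map_top, f.map_top])
    map_bot' := he (by rw [hg, e.map_bot, f.map_bot])
    map_compl' := fun a => he (by rw [e.map_compl, hg, hg, f.map_compl]) }, hg⟩

def range (f : PDLHom A B) : PDLSubalgebra B where
  carrier := Set.range f.toFun
  inf_mem := by rintro _ _ ⟨a, rfl⟩ ⟨b, rfl⟩; exact ⟨a ⊓ b, f.map_inf a b⟩
  sup_mem := by rintro _ _ ⟨a, rfl⟩ ⟨b, rfl⟩; exact ⟨a ⊔ b, f.map_sup a b⟩
  compl_mem := by rintro _ ⟨a, rfl⟩; exact ⟨aᶜ, f.map_compl a⟩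
  bot_mem := ⟨⊥, f.map_bot⟩
  top_mem := ⟨⊤, f.map_top⟩

end PDLHom

def PDLSubalgebra.subtype (S : PDLSubalgebra A) : PDLHom S.carrier A where
  toFun := Subtype.val
  map_sup' _ _ := rfl
  map_inf' _ _ := rfl
  map_top' := rfl
  map_bot' := rfl
  map_compl' _ := rfl

theorem PDLSubalgebra.closure_carrier (S : PDLSubalgebra A) :
    PDLSubalgebra.closure S.carrier = S := by
  have h : (PDLSubalgebra.closure S.carrier).carrier = S.carrier :=
    Set.Subset.antisymm (fun _ ha => ha S subset_rfl) fun _ ha _ hT => hT ha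
  cases S
  simpa [PDLSubalgebra.closure] using h

theorem PDLEmbeds.trans (h : PDLEmbeds A B) (h' : PDLEmbeds B C) : PDLEmbeds A C := by
  obtain ⟨f, hf⟩ := h
  obtain ⟨g, hg⟩ := h'
  exact ⟨g.comp f, hg.comp hf⟩

end Homomorphisms

/-! ### Algebras of upsets -/

section Upsets

/-- The upward closed subsets of a preorder. -/
def Upsets (P : Type*) [Preorder P] : Type _ := {U : Set P // IsUpperSet U}

variable {P : Type*} [Preorder P]

instance Upsets.instPDLattice : PDLattice (Upsets P) where
  toDistribLattice :=
    { (inferInstance : PartialOrder {U : Set P // IsUpperSet U}) with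
      sup := fun U V => ⟨U.1 ∪ V.1, U.2.union V.2⟩
      inf := fun U V => ⟨U.1 ∩ V.1, U.2.inter V.2⟩
      le_sup_left := fun U V => (Set.subset_union_left : U.1 ⊆ U.1 ∪ V.1)
      le_sup_right := fun U V => (Set.subset_union_right : V.1 ⊆ U.1 ∪ V.1)
      sup_le := fun U V W (h : U.1 ⊆ W.1) (h' : V.1 ⊆ W.1) =>
        (Set.union_subset h h' : U.1 ∪ V.1 ⊆ W.1)
      inf_le_left := fun U V => (Set.inter_subset_left : U.1 ∩ V.1 ⊆ U.1)
      inf_le_right := fun U V => (Set.inter_subset_right : U.1 ∩ V.1 ⊆ V.1)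
      le_inf := fun U V W (h : U.1 ⊆ V.1) (h' : U.1 ⊆ W.1) =>
        (Set.subset_inter h h' : U.1 ⊆ V.1 ∩ W.1)
      le_sup_inf := fun U V W => (Set.union_inter_distrib_left U.1 V.1 W.1).ge }
  top := ⟨Set.univ, isUpperSet_univ⟩
  le_top U := Set.subset_univ U.1
  bot := ⟨∅, isUpperSet_empty⟩
  bot_le U := Set.empty_subset U.1
  compl U := ⟨{p | ∀ q, p ≤ q → q ∉ U.1}, fun _ _ h hp q hq => hp q (h.trans hq)⟩
  le_compl_iff U V := by
    constructor
    · exact fun h => Subtype.ext (Set.eq_empty_iff_forall_notMem.2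
        fun p hp => h hp.1 p le_rfl hp.2)
    · exact fun h p hp q hq hqV => Set.eq_empty_iff_forall_notMem.1 (congrArg Subtype.val h) q
        ⟨U.2 hq hp, hqV⟩

instance : Membership P (Upsets P) := ⟨fun U p => p ∈ U.1⟩

namespace Upsets

@[ext]
theorem ext {U V : Upsets P} (h : ∀ p, p ∈ U ↔ p ∈ V) : U = V := Subtype.ext (Set.ext h)

theorem mem_of_le {U : Upsets P} {p q : P} (h : p ≤ q) (hp : p ∈ U) : q ∈ U := U.2 h hp

@[simp] theorem mem_inf {U V : Upsets P} {p : P} : p ∈ U ⊓ V ↔ p ∈ U ∧ p ∈ V := Iff.rfl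

@[simp] theorem notMem_bot {p : P} : p ∉ (⊥ : Upsets P) := fun h => h

@[simp] theorem mem_compl {U : Upsets P} {p : P} : p ∈ Uᶜ ↔ ∀ q, p ≤ q → q ∉ U := Iff.rfl

instance [Finite P] : Finite (Upsets P) := inferInstanceAs (Finite {U : Set P // IsUpperSet U})

end Upsets

/-- A homomorphism into an algebra of upsets assigns a prime filter to every point. -/
def PDLHom.dualPoint {A : Type*} [PDLattice A] (h : PDLHom A (Upsets P)) (p : P) : PDLDual A :=
  PDLDual.ofSet {a | p ∈ h.toFun a}
    (show p ∈ h.toFun ⊤ by rw [h.map_top]; trivial)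
    (show p ∉ h.toFun ⊥ by rw [h.map_bot]; exact Upsets.notMem_bot)
    (fun a b => show p ∈ h.toFun (a ⊓ b) ↔ _ by rw [h.map_inf]; rfl)
    (fun a b => show p ∈ h.toFun (a ⊔ b) ↔ _ by rw [h.map_sup]; rfl)

theorem PDLHom.mem_dualPoint {A : Type*} [PDLattice A] (h : PDLHom A (Upsets P)) {p : P} {a : A} :
    a ∈ (h.dualPoint p).1 ↔ p ∈ h.toFun a := Iff.rfl

theorem PDLHom.dualPoint_mono {A : Type*} [PDLattice A] (h : PDLHom A (Upsets P)) {p q : P}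
    (hpq : p ≤ q) : h.dualPoint p ≤ h.dualPoint q := fun _ ha => Upsets.mem_of_le hpq ha

/-- A monotone map into the dual of `A` compatible with maximal elements induces a homomorphism. -/
def Upsets.homOfDual {A : Type*} [PDLattice A] (f : P → PDLDual A) (hf : Monotone f)
    (hmax : ∀ p, ∀ y ∈ maxElems (Set.Ici (f p)), ∃ q, p ≤ q ∧ f q = y) :
    PDLHom A (Upsets P) where
  toFun a := ⟨{p | a ∈ (f p).1}, fun _ _ h ha => hf h ha⟩
  map_sup' a b := Upsets.ext fun p => (f p).sup_mem_iff
  map_inf' a b := Upsets.ext fun p => (f p).inf_mem_iff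
  map_top' := Upsets.ext fun p => ⟨fun _ => trivial, fun _ => Order.PFilter.top_mem⟩
  map_bot' := Upsets.ext fun p => ⟨fun h => (f p).bot_notMem h, fun h => h.elim⟩
  map_compl' a := Upsets.ext fun p => by
    refine (f p).compl_mem_iff.trans ⟨fun h q hpq hq => ?_, fun h y hy ha => ?_⟩
    · exact (f q).compl_notMem hq (hf hpq ((f p).compl_mem_iff.2 h))
    · obtain ⟨q, hpq, rfl⟩ := hmax p y hy
      exact h q hpq ha

theorem Upsets.homOfDual_injective {A : Type*} [PDLattice A] (f : P → PDLDual A) (hf : Monotone f)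
    (hmax : ∀ p, ∀ y ∈ maxElems (Set.Ici (f p)), ∃ q, p ≤ q ∧ f q = y)
    (hs : Function.Surjective f) : Function.Injective (Upsets.homOfDual f hf hmax).toFun := by
  have key : ∀ a b, (Upsets.homOfDual f hf hmax).toFun a = (Upsets.homOfDual f hf hmax).toFun b →
      a ≤ b := by
    intro a b h
    by_contra hn
    obtain ⟨x, hx, hx'⟩ := PDLDual.exists_mem_notMem hn
    obtain ⟨p, rfl⟩ := hs x
    have : p ∈ (Upsets.homOfDual f hf hmax).toFun b := h ▸ hx
    exact hx' this
  exact fun a b h => le_antisymm (key a b h) (key b a h.symm)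

end Upsets

/-! ### The dual of a free algebra -/

/-- The points of the dual of the free algebra on a finite set `X`: a set of variables together with
a nonempty family of sets of variables containing it. -/
structure FreePoint (X : Type*) where
  val : Set X
  top : Set (Set X)
  top_nonempty : top.Nonempty
  val_subset : ∀ w ∈ top, val ⊆ w

namespace FreePoint

variable {X : Type*}

instance : Preorder (FreePoint X) where
  le p q := p.val ⊆ q.val ∧ q.top ⊆ p.top
  le_refl p := ⟨subset_rfl, subset_rfl⟩
  le_trans p q r h h' := ⟨h.1.trans h'.1, h'.2.trans h.2⟩

instance [Finite X] : Finite (FreePoint X) :=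
  Finite.of_injective (fun p : FreePoint X => (p.val, p.top)) (by
    rintro ⟨v, S, h, h'⟩ ⟨w, T, h1, h2⟩ h3
    simpa using h3)

/-- The maximal point given by a set of variables. -/
def pure (w : Set X) : FreePoint X where
  val := w
  top := {w}
  top_nonempty := Set.singleton_nonempty w
  val_subset := fun _ h => h.ge

theorem le_pure {p : FreePoint X} {w : Set X} (h : w ∈ p.top) : p ≤ pure w :=
  ⟨p.val_subset w h, Set.singleton_subset_iff.2 h⟩

theorem pure_maximal {p : FreePoint X} {w : Set X} (h : pure w ≤ p) : p ≤ pure w := by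
  obtain ⟨u, hu⟩ := p.top_nonempty
  obtain rfl : u = w := h.2 hu
  exact le_pure hu

/-- The set of all points at which a variable holds. -/
def gen (x : X) : Upsets (FreePoint X) := ⟨{p | x ∈ p.val}, fun _ _ h hp => h.1 hp⟩

/-- The point describing a prime filter with respect to an assignment of the variables. -/
def ofDual {B : Type*} [PDLattice B] (v : X → B) (x : PDLDual B) : FreePoint X where
  val := {i | v i ∈ x.1}
  top := {w | ∃ y ∈ maxElems (Set.Ici x), w = {i | v i ∈ y.1}}
  top_nonempty := by
    obtain ⟨y, h1, h2⟩ := x.exists_ge_decides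
    exact ⟨_, y, PDLDual.mem_maxElems_Ici.2 ⟨h1, h2⟩, rfl⟩
  val_subset := by
    rintro _ ⟨y, hy, rfl⟩ i hi
    exact hy.1 hi

theorem ofDual_mono {B : Type*} [PDLattice B] (v : X → B) {x y : PDLDual B} (h : x ≤ y) :
    ofDual v x ≤ ofDual v y := by
  refine ⟨fun i hi => h hi, ?_⟩
  rintro _ ⟨z, hz, rfl⟩
  rw [PDLDual.mem_maxElems_Ici] at hz
  exact ⟨z, PDLDual.mem_maxElems_Ici.2 ⟨h.trans hz.1, hz.2⟩, rfl⟩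

/-- Only pseudocomplements need an argument, because points above `ofDual v x` need not come from
prime filters. -/
theorem ofDual_mem_eval {B : Type*} [PDLattice B] (v : X → B) (t : PDLTerm X) :
    ∀ x : PDLDual B, ofDual v x ∈ t.eval gen ↔ t.eval v ∈ x.1 := by
  induction t with
  | var i => exact fun x => Iff.rfl
  | bot => exact fun x => ⟨fun h => h.elim, fun h => (x.bot_notMem h).elim⟩
  | top => exact fun x => ⟨fun _ => Order.PFilter.top_mem, fun _ => trivial⟩
  | inf t s ht hs => exact fun x => (and_congr (ht x) (hs x)).trans x.inf_mem_iff.symm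
  | sup t s ht hs => exact fun x => (or_congr (ht x) (hs x)).trans x.sup_mem_iff.symm
  | compl t ht =>
    refine fun x => Iff.trans ?_ x.compl_mem_iff.symm
    constructor
    · exact fun h y hy hty => h _ (ofDual_mono v hy.1) ((ht y).2 hty)
    · intro h q hq hqt
      -- A set w in `q.top` comes from a maximal filter y above x, and `ofDual v y` is the point
      -- `pure w`; so t, holding at q, holds at y.
      obtain ⟨w, hw⟩ := q.top_nonempty
      obtain ⟨y, hy, rfl⟩ := hq.2 hw
      refine h y hy ((ht y).1 (Upsets.mem_of_le (le_trans (le_pure hw) ?_) hqt))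
      refine ⟨subset_rfl, ?_⟩
      rintro _ ⟨z, hz, rfl⟩
      rw [PDLDual.mem_maxElems_Ici] at hy hz
      rw [hy.2.eq_of_le hz.1]
      rfl

end FreePoint

/-! ### Free algebras as algebras of upsets of points -/

namespace PDLFree

variable {X : Type*}

theorem eval_mk_var (t : PDLTerm X) : t.eval (fun x => mk (.var x)) = mk t := by
  induction t with
  | var x => rfl
  | bot => rfl
  | top => rfl
  | compl t ih => exact congrArg (·ᶜ) ih
  | inf t s iht ihs => exact congrArg₂ (· ⊓ ·) iht ihs
  | sup t s iht ihs => exact congrArg₂ (· ⊔ ·) iht ihs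

theorem map_mk {A : Type*} [PDLattice A] (f : PDLHom (PDLFree X) A) (t : PDLTerm X) :
    f.toFun (mk t) = t.eval (fun x => f.toFun (mk (.var x))) := by
  induction t with
  | var x => rfl
  | bot => exact f.map_bot
  | top => exact f.map_top
  | compl t ih => exact (f.map_compl (mk t)).trans (congrArg (·ᶜ) ih)
  | inf t s iht ihs => exact (f.map_inf (mk t) (mk s)).trans (congrArg₂ (· ⊓ ·) iht ihs)
  | sup t s iht ihs => exact (f.map_sup (mk t) (mk s)).trans (congrArg₂ (· ⊔ ·) iht ihs)

/-- The homomorphism from the free algebra extending an assignment of the variables. -/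
noncomputable def lift {A : Type*} [PDLattice A] (v : X → A) : PDLHom (PDLFree X) A :=
  (existsUnique_lift v).choose

theorem lift_mk {A : Type*} [PDLattice A] (v : X → A) (t : PDLTerm X) :
    (lift v).toFun (mk t) = t.eval v := by
  rw [map_mk]
  congr 1
  exact funext (existsUnique_lift v).choose_spec.1

theorem mk_surjective (a : PDLFree X) : ∃ t, mk t = a := Quotient.exists_rep a

/-- A prime filter of `PDLFree X` separating two classes of terms gives a point separating their
values. No finiteness of X is needed, so this also covers `PDLFree ℕ`. -/
theorem lift_gen_injective :
    Function.Injective (lift (FreePoint.gen (X := X))).toFun := by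
  have key : ∀ a b : PDLFree X, (lift FreePoint.gen).toFun a = (lift FreePoint.gen).toFun b →
      a ≤ b := by
    intro a b h
    obtain ⟨t, rfl⟩ := mk_surjective a
    obtain ⟨s, rfl⟩ := mk_surjective b
    rw [lift_mk, lift_mk] at h
    by_contra hn
    obtain ⟨x, hx, hx'⟩ := PDLDual.exists_mem_notMem hn
    rw [← eval_mk_var, ← FreePoint.ofDual_mem_eval] at hx hx'
    exact hx' (h ▸ hx)
  exact fun a b h => le_antisymm (key a b h) (key b a h.symm)

instance [Finite X] : Finite (PDLFree X) := Finite.of_injective _ (lift_gen_injective (X := X))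

theorem embeds_of_injective {Y : Type*} {i : X → Y} (hi : Function.Injective i) :
    PDLEmbeds (PDLFree X) (PDLFree Y) := by
  classical
  let g : PDLHom (PDLFree Y) (PDLFree X) :=
    -- This is a left inverse of f; the value ⊥ outside the range of i is arbitrary.
    lift fun y => if h : ∃ x, i x = y then mk (.var h.choose) else ⊥
  let f : PDLHom (PDLFree X) (PDLFree Y) := lift fun x => mk (.var (i x))
  have hg : ∀ x, g.toFun (mk (.var (i x))) = mk (.var x) := by
    intro x
    have h : ∃ x', i x' = i x := ⟨x, rfl⟩
    rw [show g.toFun (mk (.var (i x))) = _ from lift_mk _ _]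
    simp only [PDLTerm.eval, dif_pos h]
    rw [hi h.choose_spec]
  have hgf : ∀ a, g.toFun (f.toFun a) = a := by
    intro a
    obtain ⟨t, rfl⟩ := mk_surjective a
    refine (map_mk (g.comp f) t).trans (Eq.trans ?_ (eval_mk_var t))
    congr 1
    funext x
    change g.toFun (f.toFun (mk (.var x))) = _
    rw [show f.toFun (mk (.var x)) = mk (.var (i x)) from lift_mk _ _, hg]
  exact ⟨f, Function.LeftInverse.injective hgf⟩

end PDLFree

/-! ### Generating all upsets of points from the variables -/

namespace PDLSubalgebra

variable {A : Type*} [PDLattice A]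

theorem exists_finite_inf (S : PDLSubalgebra A) {ι : Type*} (s : Set ι) (hs : s.Finite)
    (u : ι → A) (hu : ∀ i ∈ s, u i ∈ S.carrier) :
    ∃ a ∈ S.carrier, ∀ b : A, b ≤ a ↔ ∀ i ∈ s, b ≤ u i := by
  induction s, hs using Set.Finite.induction_on with
  | empty => exact ⟨⊤, S.top_mem, by simp⟩
  | @insert i s hi hs ih =>
    obtain ⟨a, ha, h⟩ := ih fun j hj => hu j (Set.mem_insert_of_mem _ hj)
    refine ⟨u i ⊓ a, S.inf_mem (hu i (Set.mem_insert _ _)) ha, fun b => ?_⟩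
    rw [le_inf_iff, h, Set.forall_mem_insert]

theorem exists_finite_sup (S : PDLSubalgebra A) {ι : Type*} (s : Set ι) (hs : s.Finite)
    (u : ι → A) (hu : ∀ i ∈ s, u i ∈ S.carrier) :
    ∃ a ∈ S.carrier, ∀ b : A, a ≤ b ↔ ∀ i ∈ s, u i ≤ b := by
  induction s, hs using Set.Finite.induction_on with
  | empty => exact ⟨⊥, S.bot_mem, by simp⟩
  | @insert i s hi hs ih =>
    obtain ⟨a, ha, h⟩ := ih fun j hj => hu j (Set.mem_insert_of_mem _ hj)
    refine ⟨u i ⊔ a, S.sup_mem (hu i (Set.mem_insert _ _)) ha, fun b => ?_⟩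
    rw [sup_le_iff, h, Set.forall_mem_insert]

end PDLSubalgebra

namespace Upsets

variable {P : Type*} [Preorder P]

theorem inter_mem (S : PDLSubalgebra (Upsets P)) {ι : Type*} [Finite ι] (s : Set ι)
    (u : ι → Upsets P) (hu : ∀ i ∈ s, u i ∈ S.carrier) :
    ∃ U ∈ S.carrier, ∀ p, p ∈ U ↔ ∀ i ∈ s, p ∈ u i := by
  obtain ⟨U, hU, h⟩ := S.exists_finite_inf s s.toFinite u hu
  refine ⟨U, hU, fun p => ⟨fun hp i hi => (h U).1 le_rfl i hi hp, fun hp => ?_⟩⟩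
  -- The order characterization of U is tested on the principal upset of p.
  have : (⟨{q | p ≤ q}, fun _ _ h h' => le_trans h' h⟩ : Upsets P) ≤ U :=
    (h _).2 fun i hi q hq => Upsets.mem_of_le hq (hp i hi)
  exact this (le_refl p)

theorem union_mem (S : PDLSubalgebra (Upsets P)) {ι : Type*} [Finite ι] (s : Set ι)
    (u : ι → Upsets P) (hu : ∀ i ∈ s, u i ∈ S.carrier) :
    ∃ U ∈ S.carrier, ∀ p, p ∈ U ↔ ∃ i ∈ s, p ∈ u i := by
  obtain ⟨U, hU, h⟩ := S.exists_finite_sup s s.toFinite u hu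
  refine ⟨U, hU, fun p => ⟨fun hp => ?_, fun ⟨i, hi, hp⟩ => (h U).1 le_rfl i hi hp⟩⟩
  have : U ≤ (⟨{q | ∃ i ∈ s, q ∈ u i}, fun _ _ h ⟨i, hi, h'⟩ =>
    ⟨i, hi, Upsets.mem_of_le h h'⟩⟩ : Upsets P) := (h _).2 fun i hi q hq => ⟨i, hi, hq⟩
  exact this hp

end Upsets

namespace FreePoint

variable {X : Type*}

/-- For finite `X`, the upsets given by the variables generate all upsets of points. -/
theorem mem_of_gen_mem [Finite X] (S : PDLSubalgebra (Upsets (FreePoint X)))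
    (hS : ∀ x, gen x ∈ S.carrier) (U : Upsets (FreePoint X)) : U ∈ S.carrier := by
  -- The upset of `pure u` consists of the points where all variables in u hold and each variable
  -- outside u fails at every point above.
  have hpure : ∀ u : Set X, ∃ E ∈ S.carrier, ∀ p, p ∈ E ↔ pure u ≤ p := by
    intro u
    obtain ⟨E₁, h₁, hE₁⟩ := Upsets.inter_mem S u gen fun i _ => hS i
    obtain ⟨E₂, h₂, hE₂⟩ := Upsets.inter_mem S uᶜ (fun i => (gen i)ᶜ) fun i _ =>
      S.compl_mem (hS i)
    refine ⟨E₁ ⊓ E₂, S.inf_mem h₁ h₂, fun p => ?_⟩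
    rw [Upsets.mem_inf, hE₁, hE₂]
    constructor
    · rintro ⟨h, h'⟩
      refine ⟨fun i hi => h i hi, fun w hw => Set.Subset.antisymm (fun i hi => ?_)
        (Set.Subset.trans (fun i hi => h i hi) (p.val_subset w hw))⟩
      by_contra hn
      exact h' i hn (pure w) (le_pure hw) hi
    · refine fun h => ⟨fun i hi => h.1 hi, fun i hi q hq hiq => ?_⟩
      exact hi ((pure_maximal (h.trans hq)).1 hiq)
  -- The upset of p is cut out by the variables in `p.val` and by forbidding, at all points above,
  -- the upsets of `pure u` with u outside `p.top`.
  have hprin : ∀ p : FreePoint X, ∃ E ∈ S.carrier, ∀ q, q ∈ E ↔ p ≤ q := by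
    intro p
    choose E hE hE' using hpure
    obtain ⟨E₁, h₁, hE₁⟩ := Upsets.inter_mem S p.val gen fun i _ => hS i
    obtain ⟨E₂, h₂, hE₂⟩ := Upsets.inter_mem S p.topᶜ (fun u => (E u)ᶜ) fun u _ =>
      S.compl_mem (hE u)
    refine ⟨E₁ ⊓ E₂, S.inf_mem h₁ h₂, fun q => ?_⟩
    rw [Upsets.mem_inf, hE₁, hE₂]
    refine and_congr Iff.rfl ⟨fun h w hw => ?_, fun h u hu r hqr hur => ?_⟩
    · by_contra hn
      exact h w hn (pure w) (le_pure hw) ((hE' w _).2 le_rfl)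
    · obtain ⟨w, hw⟩ := r.top_nonempty
      obtain rfl : w = u := ((hE' u r).1 hur).2 hw
      exact hu (h (hqr.2 hw))
  choose E hE hE' using hprin
  obtain ⟨V, hV, hV'⟩ := Upsets.union_mem S U.1 E fun p _ => hE p
  convert hV
  ext q
  rw [hV']
  exact ⟨fun h => ⟨q, h, (hE' q q).2 le_rfl⟩, fun ⟨p, hp, h⟩ =>
    Upsets.mem_of_le ((hE' p q).1 h) hp⟩

end FreePoint

theorem PDLFree.lift_gen_surjective {X : Type*} [Finite X] :
    Function.Surjective (PDLFree.lift (FreePoint.gen (X := X))).toFun :=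
  FreePoint.mem_of_gen_mem (PDLFree.lift FreePoint.gen).range
    fun x => ⟨PDLFree.mk (.var x), PDLFree.lift_mk _ _⟩

/-- An algebra embeds into a free algebra on a finite set once its dual is a suitable image. -/
theorem pdlEmbeds_free_of_surjective {A X : Type*} [PDLattice A] [Finite X]
    (f : FreePoint X → PDLDual A) (hf : Monotone f)
    (hmax : ∀ p, ∀ y ∈ maxElems (Set.Ici (f p)), ∃ q, p ≤ q ∧ f q = y)
    (hs : Function.Surjective f) : PDLEmbeds A (PDLFree ℕ) := by
  obtain ⟨g, hg⟩ := PDLHom.exists_factor (PDLFree.lift (FreePoint.gen (X := X)))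
    PDLFree.lift_gen_injective (Upsets.homOfDual f hf hmax)
    fun a => PDLFree.lift_gen_surjective _
  have hg' : PDLEmbeds A (PDLFree X) := ⟨g, fun a b h =>
    Upsets.homOfDual_injective f hf hmax hs (by rw [← hg, ← hg, h])⟩
  obtain ⟨n, ⟨e⟩⟩ := Finite.exists_equiv_fin X
  exact hg'.trans (PDLFree.embeds_of_injective
    (i := fun x => (e x : ℕ)) (Fin.val_injective.comp e.injective))

/-! ### Free skeletons -/

theorem mem_maxElems_Ici_iff {P : Type*} [PartialOrder P] {x y : P} :
    y ∈ maxElems (Set.Ici x) ↔ x ≤ y ∧ y ∈ maxElems (Set.univ : Set P) :=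
  ⟨fun h => ⟨h.1, trivial, fun _ _ hz => h.2 (le_trans h.1 hz) hz⟩,
    fun h => ⟨h.1, fun _ _ hz => h.2.2 trivial hz⟩⟩

theorem maxElems_Ici_of_maximal {P : Type*} [PartialOrder P] {a : P}
    (ha : a ∈ maxElems (Set.univ : Set P)) : maxElems (Set.Ici a) = {a} := by
  ext y
  rw [mem_maxElems_Ici_iff, Set.mem_singleton_iff]
  exact ⟨fun h => le_antisymm (ha.2 trivial h.1) h.1, fun h => h.symm ▸ ⟨le_rfl, ha⟩⟩

theorem maxElems_Ici_nonempty {P : Type*} [PartialOrder P] [Finite P] (x : P) :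
    (maxElems (Set.Ici x)).Nonempty :=
  (Set.toFinite (Set.Ici x)).exists_maximal ⟨x, le_rfl⟩

/-- A free skeleton can be chosen such that the element with the maximal elements above `x` is `x`
itself. -/
theorem HasFreeSkeleton.exists_normalized {P : Type*} [PartialOrder P] (h : HasFreeSkeleton P) :
    ∃ m : P, (∀ x, m ≤ x) ∧ ∃ s : P → Set P → P,
      (∀ x, s x (maxElems (Set.Ici x)) = x) ∧
      (∀ x Y, Y.Nonempty → Y ⊆ maxElems (Set.Ici x) → maxElems (Set.Ici (s x Y)) = Y) ∧
      (∀ x Y Z, Y.Nonempty → Z ⊆ maxElems (Set.Ici x) → Y ⊆ Z → s x Z ≤ s x Y) ∧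
      (∀ x Y, Y.Nonempty → Y ⊆ maxElems (Set.univ : Set P) → maxElems (Set.Ici x) ⊆ Y →
        s m Y ≤ x) := by
  classical
  obtain ⟨m, hm, s, h1, h2, h3⟩ := h
  -- The new value x stays below every `s x Y`, and at m it is the minimum, so monotonicity and
  -- condition (iii) survive.
  refine ⟨m, fun x => hm.2 trivial, fun x Y => if Y = maxElems (Set.Ici x) then x else s x Y,
    fun x => if_pos rfl, fun x Y hne hY => ?_, fun x Y Z hne hZ hYZ => ?_, fun x Y hne hY hx => ?_⟩
  · dsimp only
    split_ifs with h
    · exact h.symm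
    · exact (h1 x Y hne hY).2.symm
  · dsimp only
    split_ifs with h h' h'
    · exact le_rfl
    · exact (h1 x Y hne (hYZ.trans hZ)).1
    · exact absurd (hZ.antisymm (h' ▸ hYZ)) h
    · exact h2 x Y Z hne (hne.mono hYZ) (hYZ.trans hZ) hZ hYZ
  · dsimp only
    split_ifs with h
    · exact hm.2 trivial
    · exact h3 x Y hne hY hx

/-- A finite poset with a free skeleton is an image of the dual of a finitely generated free
algebra. -/
theorem HasFreeSkeleton.exists_surjective {P : Type*} [PartialOrder P] [Finite P]
    (h : HasFreeSkeleton P) :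
    ∃ f : FreePoint (P ⊕ P) → P, Monotone f ∧ Function.Surjective f ∧
      ∀ p, ∀ y ∈ maxElems (Set.Ici (f p)), ∃ q, p ≤ q ∧ f q = y := by
  classical
  obtain ⟨m, hm, s, hs, h1, h2, h3⟩ := h.exists_normalized
  obtain ⟨a₀, ha₀⟩ := maxElems_Ici_nonempty m
  have maxm : ∀ {a : P}, a ∈ maxElems (Set.univ : Set P) → a ∈ maxElems (Set.Ici m) :=
    fun ha => mem_maxElems_Ici_iff.2 ⟨hm _, ha⟩
  -- The variable `Sum.inl x` is a label and `Sum.inr a` names a maximal element. The map g below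
  -- decodes these sets and sends any set with two labels to the fixed a₀.
  let code : P → P → Set (P ⊕ P) := fun x a => {Sum.inl x, Sum.inr a}
  obtain ⟨g, hgmax, hgcode, hgtwo⟩ : ∃ g : Set (P ⊕ P) → P,
      (∀ w, g w ∈ maxElems (Set.univ : Set P)) ∧
      (∀ x, ∀ a ∈ maxElems (Set.univ : Set P), g (code x a) = a) ∧
      (∀ w x y, x ≠ y → Sum.inl x ∈ w → Sum.inl y ∈ w → g w = a₀) := by
    refine ⟨fun w => if h : ∃ a ∈ maxElems (Set.univ : Set P), ∃ x, w = code x a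
      then h.choose else a₀, fun w => ?_, fun x a ha => ?_, fun w x y hxy hx hy => ?_⟩
    · dsimp only
      split_ifs with h
      · exact h.choose_spec.1
      · exact (mem_maxElems_Ici_iff.1 ha₀).2
    · have h : ∃ b ∈ maxElems (Set.univ : Set P), ∃ y, code x a = code y b := ⟨a, ha, x, rfl⟩
      dsimp only
      rw [dif_pos h]
      obtain ⟨y, hy⟩ := h.choose_spec.2
      have : Sum.inr a ∈ code y h.choose := hy ▸ (by simp [code])
      simpa [code, eq_comm] using this
    · refine dif_neg ?_
      rintro ⟨a, -, z, rfl⟩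
      simp only [code, Set.mem_insert_iff, Sum.inl.injEq, Set.mem_singleton_iff, reduceCtorEq,
        or_false] at hx hy
      exact hxy (hx.trans hy.symm)
  let G : FreePoint (P ⊕ P) → Set P := fun p => g '' p.top
  have hGne : ∀ p, (G p).Nonempty := fun p => p.top_nonempty.image g
  have hGmax : ∀ p, G p ⊆ maxElems (Set.univ : Set P) := by
    rintro p _ ⟨w, -, rfl⟩
    exact hgmax w
  have hGmono : ∀ {p q}, p ≤ q → G q ⊆ G p := fun h => Set.image_mono h.2
  -- The points to be collapsed onto a maximal element: maximal points, whose images must be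
  -- maximal, and points with two labels, so that the label of any other point is unique. Each of
  -- them sees a single value of g.
  let C : FreePoint (P ⊕ P) → Prop := fun p =>
    p.top = {p.val} ∨ ∃ x y, x ≠ y ∧ Sum.inl x ∈ p.val ∧ Sum.inl y ∈ p.val
  let c : FreePoint (P ⊕ P) → P := fun p => g p.top_nonempty.some
  have hcG : ∀ p, c p ∈ G p := fun p => ⟨_, p.top_nonempty.some_mem, rfl⟩
  have hCG : ∀ p, C p → G p = {c p} := by
    intro p hp
    refine Set.Subset.antisymm ?_ (Set.singleton_subset_iff.2 (hcG p))
    rintro _ ⟨w, hw, rfl⟩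
    have hw' := p.top_nonempty.some_mem
    rcases hp with hp | ⟨x, y, hxy, hx, hy⟩
    · have e1 : w = p.val := by rw [hp] at hw; exact hw
      have e2 : p.top_nonempty.some = p.val := by
        have h4 : ∀ z ∈ p.top, z = p.val := fun z hz => by rw [hp] at hz; exact hz
        exact h4 _ hw'
      rw [Set.mem_singleton_iff, e1, ← e2]
    · rw [Set.mem_singleton_iff, hgtwo w x y hxy (p.val_subset w hw hx) (p.val_subset w hw hy)]
      exact (hgtwo _ x y hxy (p.val_subset _ hw' hx) (p.val_subset _ hw' hy)).symm
  have hCmono : ∀ {p q}, p ≤ q → C p → C q := by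
    rintro p q hpq (hp | ⟨x, y, hxy, hx, hy⟩)
    · left
      have h5 : ∀ w ∈ q.top, w = p.val := fun w hw => by
        have := hpq.2 hw
        rwa [hp] at this
      obtain ⟨w, hw⟩ := q.top_nonempty
      have h6 : q.val = p.val :=
        Set.Subset.antisymm (h5 w hw ▸ q.val_subset w hw) hpq.1
      rw [h6]
      exact (Set.Nonempty.subset_singleton_iff ⟨w, hw⟩).1 h5
    · exact Or.inr ⟨x, y, hxy, hpq.1 hx, hpq.1 hy⟩
  -- A label x is usable only if `G p` lies in the domain on which `s x` is controlled.
  let good : FreePoint (P ⊕ P) → P → Prop := fun p x =>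
    Sum.inl x ∈ p.val ∧ G p ⊆ maxElems (Set.Ici x)
  obtain ⟨f, hfC, hfgood, hfbot⟩ : ∃ f : FreePoint (P ⊕ P) → P, (∀ p, C p → f p = c p) ∧
      (∀ p x, ¬ C p → good p x → f p = s x (G p)) ∧
      (∀ p, ¬ C p → (∀ x, ¬ good p x) → f p = s m (G p)) := by
    refine ⟨fun p => if C p then c p else if h : ∃ x, good p x then s h.choose (G p) else s m (G p),
      fun p hp => if_pos hp, fun p x hp hx => ?_, fun p hp hx => ?_⟩
    · have h : ∃ x, good p x := ⟨x, hx⟩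
      have hx' : h.choose = x := by
        by_contra hn
        exact hp (Or.inr ⟨_, _, hn, h.choose_spec.1, hx.1⟩)
      dsimp only
      rw [if_neg hp, dif_pos h, hx']
    · dsimp only
      rw [if_neg hp, dif_neg (not_exists.2 hx)]
  have hfmax : ∀ p, maxElems (Set.Ici (f p)) = G p := by
    intro p
    by_cases hp : C p
    · rw [hfC p hp, maxElems_Ici_of_maximal (hGmax p (hcG p)), hCG p hp]
    · by_cases hx : ∃ x, good p x
      · obtain ⟨x, hx⟩ := hx
        rw [hfgood p x hp hx]
        exact h1 x _ (hGne p) hx.2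
      · rw [hfbot p hp (not_exists.1 hx)]
        exact h1 m _ (hGne p) fun a ha => maxm (hGmax p ha)
  refine ⟨f, fun p q hpq => ?_, fun x => ?_, fun p y hy => ?_⟩
  · by_cases hq : C q
    · rw [hfC q hq]
      have : c q ∈ maxElems (Set.Ici (f p)) := hfmax p ▸ hGmono hpq (hcG q)
      exact this.1
    · have hp : ¬ C p := fun h => hq (hCmono hpq h)
      -- A usable label remains usable upwards since G shrinks, so (ii) applies. Without one at p,
      -- (iii) applies whatever the label at q.
      by_cases hx : ∃ x, good p x
      · obtain ⟨x, hx⟩ := hx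
        rw [hfgood p x hp hx, hfgood q x hq ⟨hpq.1 hx.1, (hGmono hpq).trans hx.2⟩]
        exact h2 x _ _ (hGne q) hx.2 (hGmono hpq)
      · rw [hfbot p hp (not_exists.1 hx)]
        exact h3 _ _ (hGne p) (hGmax p) (hfmax q ▸ hGmono hpq)
  · let p : FreePoint (P ⊕ P) :=
      { val := {Sum.inl x}
        top := code x '' maxElems (Set.Ici x)
        top_nonempty := (maxElems_Ici_nonempty x).image _
        val_subset := by
          rintro _ ⟨a, -, rfl⟩
          simp [code] }
    have hp : ¬ C p := by
      rintro (h | ⟨y, z, hyz, hy, hz⟩)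
      · obtain ⟨a, ha⟩ := maxElems_Ici_nonempty x
        have h7 : code x a ∈ p.top := ⟨a, ha, rfl⟩
        rw [h] at h7
        have h8 : Sum.inr a ∈ p.val := (show code x a = p.val from h7) ▸ (by simp [code])
        simp [p] at h8
      · have hy' : y = x := by simpa [p] using hy
        have hz' : z = x := by simpa [p] using hz
        exact hyz (hy'.trans hz'.symm)
    have hG : G p = maxElems (Set.Ici x) := by
      ext a
      constructor
      · rintro ⟨_, ⟨b, hb, rfl⟩, rfl⟩
        rwa [hgcode x b (mem_maxElems_Ici_iff.1 hb).2]
      · exact fun ha => ⟨_, ⟨a, ha, rfl⟩, hgcode x a (mem_maxElems_Ici_iff.1 ha).2⟩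
    refine ⟨p, ?_⟩
    rw [hfgood p x hp ⟨rfl, hG.le⟩, hG, hs]
  · rw [hfmax] at hy
    obtain ⟨w, hw, rfl⟩ := hy
    refine ⟨FreePoint.pure w, FreePoint.le_pure hw, ?_⟩
    have h9 : G (FreePoint.pure w) = {g w} := Set.image_singleton
    have hC : C (FreePoint.pure w) := Or.inl rfl
    rw [hfC _ hC]
    have := hcG (FreePoint.pure w)
    rwa [h9] at this

/-! ### From an embedding into a free algebra to a free skeleton -/

section Dual

variable {A X : Type*} [PDLattice A] [Finite A]

instance : Finite (PDLDual A) :=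
  Finite.of_injective (fun x : PDLDual A => (x.1 : Set A))
    (SetLike.coe_injective.comp Subtype.val_injective)

theorem PDLDual.exists_generator (x : PDLDual A) : ∃ a : A, ∀ b, b ∈ x.1 ↔ a ≤ b := by
  have key : ∀ T : Set A, T ⊆ x.1 → ∃ a ∈ x.1, ∀ b ∈ T, a ≤ b := by
    intro T
    induction T, T.toFinite using Set.Finite.induction_on with
    | empty => exact fun _ => ⟨⊤, Order.PFilter.top_mem, by simp⟩
    | @insert c T _ _ ih =>
      intro hT
      obtain ⟨a, ha, h⟩ := ih fun b hb => hT (Set.mem_insert_of_mem _ hb)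
      refine ⟨c ⊓ a, x.inf_mem_iff.2 ⟨hT (Set.mem_insert _ _), ha⟩, ?_⟩
      rintro b (rfl | hb)
      · exact inf_le_left
      · exact inf_le_right.trans (h b hb)
  obtain ⟨a, ha, h⟩ := key x.1 subset_rfl
  exact ⟨a, fun b => ⟨h b, fun hb => Order.PFilter.mem_of_le hb ha⟩⟩

theorem PDLDual.exists_cogenerator (x : PDLDual A) : ∃ a : A, ∀ b, b ∉ x.1 ↔ b ≤ a := by
  have key : ∀ T : Set A, (∀ b ∈ T, b ∉ x.1) → ∃ a, a ∉ x.1 ∧ ∀ b ∈ T, b ≤ a := by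
    intro T
    induction T, T.toFinite using Set.Finite.induction_on with
    | empty => exact fun _ => ⟨⊥, x.bot_notMem, by simp⟩
    | @insert c T _ _ ih =>
      intro hT
      obtain ⟨a, ha, h⟩ := ih fun b hb => hT b (Set.mem_insert_of_mem _ hb)
      refine ⟨c ⊔ a, fun hn => (x.sup_mem_iff.1 hn).elim (hT c (Set.mem_insert _ _)) ha, ?_⟩
      rintro b (rfl | hb)
      · exact le_sup_left
      · exact (h b hb).trans le_sup_right
  obtain ⟨a, ha, h⟩ := key {b | b ∉ x.1} fun _ h => h
  exact ⟨a, fun b => ⟨h b, fun hb hn => ha (Order.PFilter.mem_of_le hb hn)⟩⟩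

/-- If a is the least element of x and b the largest element outside x, then a ≰ b; a point in the
image of a but not in that of b has x as its filter. -/
theorem PDLHom.dualPoint_surjective {P : Type*} [Preorder P] (h : PDLHom A (Upsets P))
    (hinj : Function.Injective h.toFun) : Function.Surjective h.dualPoint := by
  intro x
  obtain ⟨a, ha⟩ := x.exists_generator
  obtain ⟨b, hb⟩ := x.exists_cogenerator
  have hab : ¬ a ≤ b := fun hab => (hb a).2 hab ((ha a).2 le_rfl)
  have : ∃ p, p ∈ h.toFun a ∧ p ∉ h.toFun b := by
    by_contra! hn
    exact hab (h.le_of_map_le hinj hn)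
  obtain ⟨p, hpa, hpb⟩ := this
  refine ⟨p, Subtype.ext (Order.PFilter.ext _ _ (Set.ext fun c => ?_))⟩
  constructor
  · intro hc
    by_contra hn
    exact hpb (h.mono ((hb c).1 hn) hc)
  · exact fun hc => h.mono ((ha c).1 hc) hpa

/-- Let a generate a maximal filter y above that of p. Then aᶜ fails at p, so a holds at some q
above p and at `pure w` for w in `q.top`; the filter of `pure w` contains y and hence equals it.
Finiteness of A provides the generator. -/
theorem PDLHom.maxElems_dualPoint (h : PDLHom A (Upsets (FreePoint X))) (p : FreePoint X) :
    maxElems (Set.Ici (h.dualPoint p)) = (fun w => h.dualPoint (FreePoint.pure w)) '' p.top := by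
  have hdec : ∀ w, (h.dualPoint (FreePoint.pure w)).Decides := by
    intro w a
    by_cases ha : FreePoint.pure w ∈ h.toFun a
    · exact Or.inl ha
    · refine Or.inr ?_
      rw [h.mem_dualPoint, h.map_compl, Upsets.mem_compl]
      exact fun q hq hqa => ha (Upsets.mem_of_le (FreePoint.pure_maximal hq) hqa)
  ext y
  constructor
  · intro hy
    obtain ⟨a, ha⟩ := y.exists_generator
    have hn : p ∉ h.toFun aᶜ := fun hp => y.compl_notMem ((ha a).2 le_rfl) (hy.1 hp)
    rw [h.map_compl, Upsets.mem_compl] at hn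
    push Not at hn
    obtain ⟨q, hpq, hqa⟩ := hn
    obtain ⟨w, hw⟩ := q.top_nonempty
    refine ⟨w, hpq.2 hw, ?_⟩
    refine ((PDLDual.mem_maxElems_Ici.1 hy).2.eq_of_le fun b hb => ?_).symm
    exact h.mono ((ha b).1 hb) (Upsets.mem_of_le (FreePoint.le_pure hw) hqa)
  · rintro ⟨w, hw, rfl⟩
    exact PDLDual.mem_maxElems_Ici.2 ⟨h.dualPoint_mono (FreePoint.le_pure hw), hdec w⟩

theorem hasFreeSkeleton_of_embeds (hA : PDLEmbeds A (PDLFree X)) :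
    HasFreeSkeleton (PDLDual A) := by
  classical
  obtain ⟨e, he⟩ := hA
  let h : PDLHom A (Upsets (FreePoint X)) := (PDLFree.lift FreePoint.gen).comp e
  have hinj : Function.Injective h.toFun := PDLFree.lift_gen_injective.comp he
  let f := h.dualPoint
  have hf : ∀ {p q}, p ≤ q → f p ≤ f q := fun hpq => h.dualPoint_mono hpq
  have hmax : ∀ p, maxElems (Set.Ici (f p)) = (fun w => f (FreePoint.pure w)) '' p.top :=
    h.maxElems_dualPoint
  let p₀ : FreePoint X := ⟨∅, Set.univ, Set.univ_nonempty, fun _ _ => Set.empty_subset _⟩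
  have hp₀ : ∀ p, p₀ ≤ p := fun p => ⟨Set.empty_subset _, Set.subset_univ _⟩
  -- The section must pick the least point p₀ over the minimum: condition (iii) compares it with
  -- arbitrary `r x`, using that its variable set is empty and its family is full.
  obtain ⟨r, hr, hr₀⟩ : ∃ r : PDLDual A → FreePoint X, (∀ x, f (r x) = x) ∧ r (f p₀) = p₀ := by
    choose r hr using h.dualPoint_surjective hinj
    refine ⟨Function.update r (f p₀) p₀, fun x => ?_, Function.update_self _ _ _⟩
    by_cases hx : x = f p₀
    · rw [hx, Function.update_self]
    · rw [Function.update_of_ne hx]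
      exact hr x
  let T : PDLDual A → Set (PDLDual A) → Set (Set X) := fun x Y =>
    {w | w ∈ (r x).top ∧ f (FreePoint.pure w) ∈ Y}
  have hT : ∀ {x Y}, Y ⊆ maxElems (Set.Ici x) →
      (fun w => f (FreePoint.pure w)) '' T x Y = Y := by
    intro x Y hY
    ext y
    constructor
    · rintro ⟨w, hw, rfl⟩
      exact hw.2
    · intro hy
      have := hY hy
      rw [← hr x, hmax] at this
      obtain ⟨w, hw, rfl⟩ := this
      exact ⟨w, ⟨hw, hy⟩, rfl⟩
  have hTne : ∀ {x Y}, Y.Nonempty → Y ⊆ maxElems (Set.Ici x) → (T x Y).Nonempty := by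
    intro x Y hne hY
    rw [← hT hY] at hne
    exact hne.of_image
  let pt : ∀ x Y, (T x Y).Nonempty → FreePoint X := fun x Y hne =>
    ⟨(r x).val, T x Y, hne, fun w hw => (r x).val_subset w hw.1⟩
  let s : PDLDual A → Set (PDLDual A) → PDLDual A := fun x Y =>
    -- The default x is never used for relevant Y, by `hTne`.
    if hne : (T x Y).Nonempty then f (pt x Y hne) else x
  have hs : ∀ {x Y} (hne : (T x Y).Nonempty), s x Y = f (pt x Y hne) := fun hne => dif_pos hne
  have hmin : ∀ x, f p₀ ≤ x := fun x => hr x ▸ hf (hp₀ _)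
  refine ⟨f p₀, ⟨trivial, fun x _ => hmin x⟩, s, ?_, ?_, ?_⟩
  · intro x Y hne hY
    have hne' := hTne hne hY
    rw [hs hne']
    refine ⟨?_, ?_⟩
    · have : f (r x) ≤ f (pt x Y hne') := hf ⟨subset_rfl, fun w hw => hw.1⟩
      rwa [hr] at this
    · rw [hmax]
      exact (hT hY).symm
  · intro x Y Z hYne hZne hY hZ hYZ
    rw [hs (hTne hYne hY), hs (hTne hZne hZ)]
    exact hf ⟨subset_rfl, fun w hw => ⟨hw.1, hYZ hw.2⟩⟩
  · intro x Y hne hY hx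
    have hY' : Y ⊆ maxElems (Set.Ici (f p₀)) := fun y hy =>
      mem_maxElems_Ici_iff.2 ⟨hmin y, hY hy⟩
    rw [hs (hTne hne hY'), ← hr x]
    refine hf ⟨?_, fun w hw => ⟨?_, hx ?_⟩⟩
    · change (r (f p₀)).val ⊆ _
      rw [hr₀]
      exact Set.empty_subset _
    · rw [hr₀]
      trivial
    · rw [← hr x, hmax]
      exact ⟨w, hw, rfl⟩

end Dual

/-! ### The two equivalences -/

theorem pdlEmbeds_free_iff {A : Type*} [PDLattice A] [Finite A] :
    PDLEmbeds A (PDLFree ℕ) ↔ HasFreeSkeleton (PDLDual A) := by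
  refine ⟨hasFreeSkeleton_of_embeds, fun h => ?_⟩
  obtain ⟨f, hf, hs, hmax⟩ := h.exists_surjective
  exact pdlEmbeds_free_of_surjective f hf hmax hs

/-- Finitely generated pseudocomplemented distributive lattices are finite. -/
theorem PDLSubalgebra.IsFinitelyGenerated.finite {B : Type*} [PDLattice B] {S : PDLSubalgebra B}
    (hS : S.IsFinitelyGenerated) : Finite S.carrier := by
  obtain ⟨Z, hZ, rfl⟩ := hS
  have := hZ.to_subtype
  -- The range of this map from a finite free algebra contains the generators, hence the whole
  -- subalgebra.
  let φ : PDLHom (PDLFree Z) B := PDLFree.lift Subtype.val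
  refine Set.Finite.subset (Set.finite_range φ.toFun) fun b hb => hb φ.range fun z hz => ?_
  exact ⟨PDLFree.mk (.var ⟨z, hz⟩), PDLFree.lift_mk _ _⟩

/-- Finitely generated subalgebras are finite, and a finite image of A is generated by its own
elements. -/
theorem isExactPDL_iff {A : Type*} [PDLattice A] :
    IsExactPDL A ↔ Finite A ∧ PDLEmbeds A (PDLFree ℕ) := by
  constructor
  · rintro ⟨S, hS, f, hf⟩
    have := hS.finite
    exact ⟨Finite.of_injective _ hf.1, S.subtype.comp f, Subtype.val_injective.comp hf.1⟩
  · rintro ⟨hA, f, hf⟩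
    refine ⟨f.range, ⟨f.range.carrier, Set.finite_range f.toFun, f.range.closure_carrier.symm⟩, ?_⟩
    obtain ⟨g, hg⟩ := PDLHom.exists_factor f.range.subtype Subtype.val_injective f
      fun a => ⟨⟨f.toFun a, a, rfl⟩, rfl⟩
    refine ⟨g, fun a b hab => hf (by rw [← hg, ← hg, hab]), ?_⟩
    rintro ⟨_, a, rfl⟩
    exact ⟨a, Subtype.ext (hg a)⟩

theorem mainTheorem2 {A : Type*} [PDLattice A] :
    (Finite A → (PDLEmbeds A (PDLFree ℕ) ↔ HasFreeSkeleton (PDLDual A))) ∧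
    (IsExactPDL A ↔ Finite A ∧ HasFreeSkeleton (PDLDual A)) :=
  ⟨fun _ => pdlEmbeds_free_iff,
    isExactPDL_iff.trans (and_congr_right fun _ => pdlEmbeds_free_iff)⟩
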